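/- Let $R$ be a commutative noetherian local ring with maximal ideal $\mathfrak m$ and residue field $k=R/\mathfrak m$. For $i\ge 0$ let $\mu^i(R)=\dim_k \operatorname{Ext}^i_R(k,R)$ denote the $i$-th Bass number of $R$ and, for a finitely generated $R$-module $M$, let $\beta_i(M)=\dim_k\operatorname{Ext}^i_R(M,k)$ denote its $i$-th Betti number. Write $\ell$ for the length of an $R$-module. (a) If $R$ is Cohen–Macaulay and $\mu^n(R)=1$ for some $n\ge 0$, then $R$ is Gorenstein of Krull dimension $n$. (b) Suppose that $R$ is artinian, and let $M$ be a finitely generated $R$-module that is not free. If $\ell(R)$ divides $\ell(M)$, then $\beta_i(M)\ge 2$ for all $i\ge 0$. If moreover $\ell(M)=\ell(R)$, then $\beta_1(M)\ge\beta_0(M)$. -/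

import Mathlib

universe u

open CategoryTheory

namespace LocalAlgebra

section Ext

variable (R : Type u) [CommRing R] [IsLocalRing R]

/-- The residue field `k = R ⧸ m` as an object of the category of `R`-modules. -/
noncomputable abbrev residueModule : ModuleCat.{u} R :=
  ModuleCat.of R (IsLocalRing.ResidueField R)

variable {R}

theorem smul_id_residueModule_eq_zero {r : R} (hr : r ∈ IsLocalRing.maximalIdeal R) :
    r • 𝟙 (residueModule R) = 0 := by
  ext x
  change r • x = 0
  rw [Algebra.smul_def, IsLocalRing.ResidueField.algebraMap_eq,
    (IsLocalRing.residue_eq_zero_iff r).mpr hr, zero_mul]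

/-- The maximal ideal annihilates `Ext^i(k, N)`. -/
theorem isTorsionBySet_ext_residue_left (N : ModuleCat.{u} R) (i : ℕ) :
    Module.IsTorsionBySet R (Abelian.Ext (residueModule R) N i)
      (IsLocalRing.maximalIdeal R : Set R) := by
  rintro x ⟨r, hr⟩
  have h : r • x = (Abelian.Ext.mk₀ (r • 𝟙 (residueModule R))).comp x (zero_add i) := by
    simp [Abelian.Ext.mk₀_smul]
  change r • x = 0
  rw [h, smul_id_residueModule_eq_zero hr, Abelian.Ext.mk₀_zero, Abelian.Ext.zero_comp]

/-- The maximal ideal annihilates `Ext^i(M, k)`. -/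
theorem isTorsionBySet_ext_residue_right (M : ModuleCat.{u} R) (i : ℕ) :
    Module.IsTorsionBySet R (Abelian.Ext M (residueModule R) i)
      (IsLocalRing.maximalIdeal R : Set R) := by
  rintro x ⟨r, hr⟩
  have h : r • x = x.comp (Abelian.Ext.mk₀ (r • 𝟙 (residueModule R))) (add_zero i) := by
    simp [Abelian.Ext.mk₀_smul]
  change r • x = 0
  rw [h, smul_id_residueModule_eq_zero hr, Abelian.Ext.mk₀_zero, Abelian.Ext.comp_zero]

/-- The `k`-vector space structure on `Ext^i(k, N)` induced by its `R`-module structure. -/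
noncomputable abbrev residueFieldModuleExtLeft (N : ModuleCat.{u} R) (i : ℕ) :
    Module (IsLocalRing.ResidueField R) (Abelian.Ext (residueModule R) N i) :=
  (isTorsionBySet_ext_residue_left N i).module

/-- The `k`-vector space structure on `Ext^i(M, k)` induced by its `R`-module structure. -/
noncomputable abbrev residueFieldModuleExtRight (M : ModuleCat.{u} R) (i : ℕ) :
    Module (IsLocalRing.ResidueField R) (Abelian.Ext M (residueModule R) i) :=
  (isTorsionBySet_ext_residue_right M i).module

end Ext

/-- The `i`-th Bass number `μ^i(R) = dim_k Ext^i_R(k, R)` of a local ring. -/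
noncomputable def bassNumber (R : Type u) [CommRing R] [IsLocalRing R] (i : ℕ) : ℕ :=
  letI := residueFieldModuleExtLeft (ModuleCat.of R R) i
  Module.finrank (IsLocalRing.ResidueField R)
    (Abelian.Ext (residueModule R) (ModuleCat.of R R) i)

/-- The `i`-th Betti number `β_i(M) = dim_k Ext^i_R(M, k)` of a module over a local ring. -/
noncomputable def bettiNumber (R : Type u) [CommRing R] [IsLocalRing R]
    (M : Type u) [AddCommGroup M] [Module R M] (i : ℕ) : ℕ :=
  letI := residueFieldModuleExtRight (ModuleCat.of R M) i
  Module.finrank (IsLocalRing.ResidueField R)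
    (Abelian.Ext (ModuleCat.of R M) (residueModule R) i)

/-- The depth of a local ring: the supremum of the lengths of the `R`-regular sequences
contained in the maximal ideal. -/
noncomputable def depth (R : Type u) [CommRing R] [IsLocalRing R] : ℕ∞ :=
  ⨆ (rs : List R) (_ : (∀ r ∈ rs, r ∈ IsLocalRing.maximalIdeal R) ∧
    RingTheory.Sequence.IsRegular R rs), (rs.length : ℕ∞)

/-- A noetherian local ring is Cohen–Macaulay if its depth equals its Krull dimension. -/
def IsCohenMacaulay (R : Type u) [CommRing R] [IsNoetherianRing R] [IsLocalRing R] : Prop :=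
  (depth R : WithBot ℕ∞) = ringKrullDim R

/-- A noetherian local ring is Gorenstein if it has finite injective dimension as a module
over itself. -/
def IsGorenstein (R : Type u) [CommRing R] [IsNoetherianRing R] [IsLocalRing R] : Prop :=
  ∃ n : ℕ, HasInjectiveDimensionLE (ModuleCat.of R R) n

end LocalAlgebra

/-!
Over an artinian local ring `R`, let `F = R^b → M` be a minimal free cover with kernel `K`, so
that `β_{i+1}(M) = β_i(K)` and `ℓ(K) = b ℓ(R) - ℓ(M)`. Divisibility of the length by `ℓ(R)` passes
from `M` to `K`, and a module with `β_0 ≤ 1` whose length is divisible by `ℓ(R)` is free. Since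
`K ⊆ m F` is killed by the socle of `R`, it cannot be free unless it is zero; hence `β_i(M) ≤ 1`
for a single `i` forces `M` to be free.

For Bass numbers, let `E` be the injective hull of the residue field. Then `ℓ(E) = ℓ(R)`,
`End(E) = R` and `Ext^n(k, Hom(N, E))` has the same length as `Ext^n(N, k)`, so that
`μ^n(R) = β_n(E)`. If this is `1` then `E` is free, and `R` is a direct summand of `E`, hence
self-injective. The Cohen–Macaulay case reduces to this one by induction on a maximal regular
sequence: for a regular `x ∈ m`, Rees' isomorphism
`Ext^{n+1}_R(N, M) ≅ Ext^n_{R/x}(N, M/xM)` lowers Bass numbers by one degree, and together with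
Nakayama's lemma and prime filtrations it shows that the injective dimension of `R` is at most one
more than that of `R/x`.
-/

universe v

namespace LocalAlgebra

section Length

variable {R M N : Type*} [Ring R] [AddCommGroup M] [AddCommGroup N] [Module R M] [Module R N]

theorem injective_of_surjective_of_length_le {f : M →ₗ[R] N} (hf : Function.Surjective f)
    (h : Module.length R M ≤ Module.length R N) (hN : Module.length R N ≠ ⊤) :
    Function.Injective f := by
  have hadd := Module.length_eq_add_of_exact (LinearMap.ker f).subtype f
    (Submodule.subtype_injective _) hf (LinearMap.exact_subtype_ker_map f)
  have hker : Module.length R (LinearMap.ker f) + Module.length R N ≤ 0 + Module.length R N := by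
    rwa [← hadd, zero_add]
  rw [ENat.add_le_add_iff_right hN, nonpos_iff_eq_zero, Module.length_eq_zero_iff] at hker
  exact LinearMap.ker_eq_bot.mp (Submodule.subsingleton_iff_eq_bot.mp hker)

theorem surjective_of_injective_of_length_le {f : M →ₗ[R] N} (hf : Function.Injective f)
    (h : Module.length R N ≤ Module.length R M) (hM : Module.length R M ≠ ⊤) :
    Function.Surjective f := by
  have hadd := Module.length_eq_add_of_exact f (LinearMap.range f).mkQ hf
    (Submodule.mkQ_surjective _) (LinearMap.exact_map_mkQ_range f)
  have hcoker : Module.length R M + Module.length R (N ⧸ LinearMap.range f) ≤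
      Module.length R M + 0 := by
    rwa [← hadd, add_zero]
  rw [ENat.add_le_add_iff_left hM, nonpos_iff_eq_zero, Module.length_eq_zero_iff,
    Submodule.Quotient.subsingleton_iff] at hcoker
  exact LinearMap.range_eq_top.mp hcoker

theorem length_le_add_of_exact {P : Type*} [AddCommGroup P] [Module R P] {f : M →ₗ[R] N}
    {g : N →ₗ[R] P} (h : Function.Exact f g) :
    Module.length R N ≤ Module.length R M + Module.length R P := by
  have hadd := Module.length_eq_add_of_exact (LinearMap.range f).subtype g.rangeRestrict
    (Submodule.subtype_injective _) g.surjective_rangeRestrict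
    (LinearMap.exact_iff.mpr (by
      rw [LinearMap.ker_rangeRestrict, Submodule.range_subtype, h.linearMap_ker_eq]))
  rw [hadd]
  exact add_le_add (Module.length_le_of_surjective f.rangeRestrict f.surjective_rangeRestrict)
    (Module.length_le_of_injective (LinearMap.range g).subtype (Submodule.subtype_injective _))

theorem enat_dvd_of_add_eq_natCast_mul {a b d : ℕ∞} {n : ℕ} (hd₀ : d ≠ 0) (hd : d ≠ ⊤)
    (h : a + b = n * d) (hb : d ∣ b) : d ∣ a := by
  obtain ⟨c, rfl⟩ := hb
  have hfin : a + d * c ≠ ⊤ := h ▸ WithTop.mul_ne_top (ENat.natCast_ne_top n) hd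
  have ha : a ≠ ⊤ := fun ha => hfin (by rw [ha, top_add])
  have hc : c ≠ ⊤ := fun hc => hfin (by rw [hc, ENat.mul_top hd₀, add_top])
  lift a to ℕ using ha
  lift c to ℕ using hc
  lift d to ℕ using hd
  norm_cast at h
  have hdvd : d ∣ a := (Nat.dvd_add_left (dvd_mul_right d c)).mp (h ▸ dvd_mul_left d n)
  exact_mod_cast Nat.cast_dvd_cast hdvd

end Length

section Numbers

variable {R : Type u} [CommRing R] [IsLocalRing R]

theorem finrank_residueField_eq_toNat_length {V : Type*} [AddCommGroup V] [Module R V]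
    (hV : Module.IsTorsionBySet R V (IsLocalRing.maximalIdeal R : Set R)) :
    letI : Module (IsLocalRing.ResidueField R) V := hV.module
    Module.finrank (IsLocalRing.ResidueField R) V = (Module.length R V).toNat := by
  let : Module (IsLocalRing.ResidueField R) V := hV.module
  have : IsScalarTower R (IsLocalRing.ResidueField R) V := hV.isScalarTower
  rw [Module.length_eq_of_surjective (IsLocalRing.residue_surjective (R := R)),
    Module.length_eq_rank, Cardinal.toNat_toENat]
  rfl

theorem bassNumber_eq_toNat_length (n : ℕ) : bassNumber R n =
    (Module.length R (Abelian.Ext (residueModule R) (ModuleCat.of R R) n)).toNat :=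
  finrank_residueField_eq_toNat_length (isTorsionBySet_ext_residue_left (ModuleCat.of R R) n)

theorem bettiNumber_eq_toNat_length (M : Type u) [AddCommGroup M] [Module R M] (n : ℕ) :
    bettiNumber R M n =
      (Module.length R (Abelian.Ext (ModuleCat.of R M) (residueModule R) n)).toNat :=
  finrank_residueField_eq_toNat_length (isTorsionBySet_ext_residue_right (ModuleCat.of R M) n)

end Numbers

section DimensionShift

variable {R : Type u} [CommRing R]

theorem length_ext_zero (X Y : ModuleCat.{u} R) :
    Module.length R (Abelian.Ext X Y 0) = Module.length R (X →ₗ[R] Y) :=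
  (Abelian.Ext.linearEquiv₀.trans ModuleCat.homLinearEquiv).length_eq

theorem length_ext_congr_left {X X' : ModuleCat.{u} R} (e : X ≅ X') (Y : ModuleCat.{u} R)
    (n : ℕ) : Module.length R (Abelian.Ext X Y n) = Module.length R (Abelian.Ext X' Y n) :=
  (LinearEquiv.ofLinearMap
    (Abelian.Ext.bilinearCompOfLinear R X' X Y 0 n n (zero_add n) (Abelian.Ext.mk₀ e.inv))
    (Abelian.Ext.bilinearCompOfLinear R X X' Y 0 n n (zero_add n) (Abelian.Ext.mk₀ e.hom))
    (by ext; simp) (by ext; simp)).length_eq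

theorem length_ext_congr_right (X : ModuleCat.{u} R) {Y Y' : ModuleCat.{u} R} (e : Y ≅ Y')
    (n : ℕ) : Module.length R (Abelian.Ext X Y n) = Module.length R (Abelian.Ext X Y' n) :=
  (LinearEquiv.ofLinearMap
    ((Abelian.Ext.bilinearCompOfLinear R X Y Y' n 0 n (add_zero n)).flip (Abelian.Ext.mk₀ e.hom))
    ((Abelian.Ext.bilinearCompOfLinear R X Y' Y n 0 n (add_zero n)).flip (Abelian.Ext.mk₀ e.inv))
    (by ext; simp) (by ext; simp)).length_eq

variable {S : ShortComplex (ModuleCat.{u} R)} (hS : S.ShortExact) (Y : ModuleCat.{u} R)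
include hS

theorem length_ext_succ_of_projective [Projective S.X₂] (h : ∀ g : S.X₂ ⟶ Y, S.f ≫ g = 0)
    (n : ℕ) :
    Module.length R (Abelian.Ext S.X₃ Y (n + 1)) = Module.length R (Abelian.Ext S.X₁ Y n) := by
  refine (LinearEquiv.ofBijective (Abelian.Ext.bilinearCompOfLinear R S.X₃ S.X₁ Y 1 n (n + 1)
    (add_comm 1 n) hS.extClass) ⟨?_, fun x => ?_⟩).length_eq.symm
  · rw [injective_iff_map_eq_zero]
    intro x hx
    obtain ⟨y, rfl⟩ := Abelian.Ext.contravariant_sequence_exact₁ hS Y x (add_comm 1 n) hx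
    cases n with
    | zero =>
      obtain ⟨g, rfl⟩ := (Abelian.Ext.mk₀_bijective _ _).2 y
      rw [Abelian.Ext.mk₀_comp_mk₀, h, Abelian.Ext.mk₀_zero]
    | succ n => rw [Abelian.Ext.eq_zero_of_projective y, Abelian.Ext.comp_zero]
  · exact Abelian.Ext.contravariant_sequence_exact₃ hS Y x
      (Abelian.Ext.eq_zero_of_projective _) (add_comm 1 n)

theorem length_ext_succ_of_injective [Injective S.X₂] (h : ∀ g : Y ⟶ S.X₂, g ≫ S.g = 0)
    (n : ℕ) :
    Module.length R (Abelian.Ext Y S.X₁ (n + 1)) = Module.length R (Abelian.Ext Y S.X₃ n) := by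
  refine (LinearEquiv.ofBijective ((Abelian.Ext.bilinearCompOfLinear R Y S.X₃ S.X₁ n 1 (n + 1)
    rfl).flip hS.extClass) ⟨?_, fun x => ?_⟩).length_eq.symm
  · rw [injective_iff_map_eq_zero]
    intro x hx
    obtain ⟨y, rfl⟩ := Abelian.Ext.covariant_sequence_exact₃ Y hS x rfl hx
    cases n with
    | zero =>
      obtain ⟨g, rfl⟩ := (Abelian.Ext.mk₀_bijective _ _).2 y
      rw [Abelian.Ext.mk₀_comp_mk₀, h, Abelian.Ext.mk₀_zero]
    | succ n => rw [Abelian.Ext.eq_zero_of_injective y, Abelian.Ext.zero_comp]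
  · exact Abelian.Ext.covariant_sequence_exact₁ Y hS x (Abelian.Ext.eq_zero_of_injective _) rfl

end DimensionShift

section ResidueField

variable {R : Type*} [CommRing R] [IsLocalRing R]

instance isSimpleModule_residueField : IsSimpleModule R (IsLocalRing.ResidueField R) :=
  isSimpleModule_iff_quot_maximal.mpr
    ⟨IsLocalRing.maximalIdeal R, inferInstance, ⟨LinearEquiv.refl R _⟩⟩

theorem nonempty_residueField_equiv (V : Type*) [AddCommGroup V] [Module R V]
    [hV : IsSimpleModule R V] : Nonempty (V ≃ₗ[R] IsLocalRing.ResidueField R) := by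
  obtain ⟨I, hI, ⟨e⟩⟩ := isSimpleModule_iff_quot_maximal.mp hV
  obtain rfl := IsLocalRing.eq_maximalIdeal hI
  exact ⟨e⟩

theorem isTorsionBySet_residueField :
    Module.IsTorsionBySet R (IsLocalRing.ResidueField R)
      (IsLocalRing.maximalIdeal R : Set R) := by
  rintro x ⟨r, hr⟩
  change r • x = 0
  rw [Algebra.smul_def, IsLocalRing.ResidueField.algebraMap_eq,
    (IsLocalRing.residue_eq_zero_iff r).mpr hr, zero_mul]

theorem map_eq_zero_of_mem_smul_top {R N V : Type*} [CommRing R] [AddCommGroup N] [Module R N]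
    [AddCommGroup V] [Module R V] {I : Ideal R} (hV : Module.IsTorsionBySet R V (I : Set R))
    (g : N →ₗ[R] V) {x : N} (hx : x ∈ I • (⊤ : Submodule R N)) : g x = 0 := by
  suffices I • ⊤ ≤ LinearMap.ker g from this hx
  rw [Submodule.smul_le]
  intro r hr y _
  rw [LinearMap.mem_ker, map_smul]
  exact @hV _ ⟨r, hr⟩

theorem length_pi_linearMap_residueField (b : ℕ) :
    Module.length R ((Fin b → R) →ₗ[R] IsLocalRing.ResidueField R) = b := by
  rw [← ((Pi.basisFun R (Fin b)).constr R (M' := IsLocalRing.ResidueField R)).length_eq,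
    Module.length_pi_of_fintype]
  simp [Module.length_eq_one]

end ResidueField

section MinimalCover

variable {R : Type u} [CommRing R] [IsLocalRing R]

/-- A minimal cover of a module over a local ring `(R, m)`: a surjection `f : F → M` with
`ker f ⊆ m F`. For `F` free and `M` finite this is the first step of a minimal free resolution. -/
structure IsMinimalCover {F M : Type*} [AddCommGroup F] [Module R F] [AddCommGroup M] [Module R M]
    (f : F →ₗ[R] M) : Prop where
  surjective : Function.Surjective f
  ker_le : LinearMap.ker f ≤ IsLocalRing.maximalIdeal R • ⊤

open TensorProduct in
theorem exists_isMinimalCover (M : Type*) [AddCommGroup M] [Module R M] [Module.Finite R M] :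
    ∃ (b : ℕ) (f : (Fin b → R) →ₗ[R] M), IsMinimalCover f := by
  let k := IsLocalRing.ResidueField R
  let B := Module.finBasis k (k ⊗[R] M)
  obtain ⟨v, hv⟩ :=
    (TensorProduct.mk_surjective R M k Ideal.Quotient.mk_surjective).comp_left B
  replace hv : ∀ i, (1 : k) ⊗ₜ[R] v i = B i := congrFun hv
  refine ⟨_, Fintype.linearCombination R v, ?_, fun x hx => ?_⟩
  · rw [← LinearMap.range_eq_top, Fintype.range_linearCombination]
    exact IsLocalRing.span_eq_top_of_tmul_eq_basis v B hv
  · have hsum : ∑ j, IsLocalRing.residue R (x j) • B j = 0 := by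
      calc ∑ j, IsLocalRing.residue R (x j) • B j
          = ∑ j, (1 : k) ⊗ₜ[R] (x j • v j) := by
            refine Finset.sum_congr rfl fun j _ => ?_
            rw [TensorProduct.tmul_smul, hv j]
            exact algebraMap_smul k (x j) (B j)
        _ = (1 : k) ⊗ₜ[R] Fintype.linearCombination R v x := by
            rw [Fintype.linearCombination_apply, TensorProduct.tmul_sum]
        _ = 0 := by rw [LinearMap.mem_ker.mp hx, TensorProduct.tmul_zero]
    have hx' (i) : x i ∈ IsLocalRing.maximalIdeal R := (IsLocalRing.residue_eq_zero_iff _).mp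
      (Fintype.linearIndependent_iff.mp B.linearIndependent _ hsum i)
    rw [pi_eq_sum_univ' x]
    exact Submodule.sum_mem _ fun i _ => Submodule.smul_mem_smul (hx' i) Submodule.mem_top

namespace IsMinimalCover

variable {M : Type u} [AddCommGroup M] [Module R M] {b : ℕ} {f : (Fin b → R) →ₗ[R] M}

theorem bettiNumber_zero (hf : IsMinimalCover f) : bettiNumber R M 0 = b := by
  rw [bettiNumber_eq_toNat_length, length_ext_zero]
  suffices Function.Bijective (LinearMap.lcomp R (IsLocalRing.ResidueField R) f) by
    rw [(LinearEquiv.ofBijective _ this).length_eq, length_pi_linearMap_residueField,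
      ENat.toNat_natCast]
  refine ⟨LinearMap.lcomp_injective_of_surjective f hf.surjective, fun g => ?_⟩
  refine (LinearMap.exact_lcomp_of_exact_of_surjective _ (LinearMap.exact_subtype_ker_map f)
    hf.surjective g).mp (LinearMap.ext fun x => ?_)
  exact map_eq_zero_of_mem_smul_top isTorsionBySet_residueField g (hf.ker_le x.2)

theorem length_ext_succ (hf : IsMinimalCover f) (n : ℕ) :
    Module.length R (Abelian.Ext (ModuleCat.of R M) (residueModule R) (n + 1)) =
      Module.length R (Abelian.Ext (ModuleCat.of R (LinearMap.ker f)) (residueModule R) n) := by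
  have : Projective f.shortComplexKer.X₂ :=
    inferInstanceAs (Projective (ModuleCat.of R (Fin b → R)))
  refine length_ext_succ_of_projective
    (LinearMap.shortExact_shortComplexKer hf.surjective) _ (fun g => ?_) n
  ext x
  exact map_eq_zero_of_mem_smul_top isTorsionBySet_residueField g.hom (hf.ker_le x.2)

theorem bettiNumber_succ (hf : IsMinimalCover f) (n : ℕ) :
    bettiNumber R M (n + 1) = bettiNumber R (LinearMap.ker f) n := by
  rw [bettiNumber_eq_toNat_length, bettiNumber_eq_toNat_length, hf.length_ext_succ]

end IsMinimalCover

theorem length_ker_add_length {R M : Type*} [Ring R] [AddCommGroup M] [Module R M] {b : ℕ}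
    {f : (Fin b → R) →ₗ[R] M} (hf : Function.Surjective f) :
    Module.length R (LinearMap.ker f) + Module.length R M = b * Module.length R R := by
  rw [← Module.length_eq_add_of_exact (LinearMap.ker f).subtype f
    (Submodule.subtype_injective _) hf (LinearMap.exact_subtype_ker_map f)]
  simp [Module.length_pi_of_fintype]

theorem free_of_surjective_of_length_le {R M : Type*} [Ring R] [IsArtinianRing R]
    [AddCommGroup M] [Module R M] {b : ℕ} {f : (Fin b → R) →ₗ[R] M} (hf : Function.Surjective f)
    (h : b * Module.length R R ≤ Module.length R M) : Module.Free R M := by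
  have := Module.Finite.of_surjective f hf
  refine Module.Free.of_equiv (LinearEquiv.ofBijective f
    ⟨injective_of_surjective_of_length_le hf ?_ Module.length_ne_top, hf⟩)
  simpa [Module.length_pi_of_fintype] using h

end MinimalCover

section Artinian

variable {R : Type u} [CommRing R] [IsArtinianRing R] [IsLocalRing R]

theorem exists_ne_zero_maximalIdeal_smul_eq_zero (N : Type*) [AddCommGroup N] [Module R N]
    [Nontrivial N] : ∃ x : N, x ≠ 0 ∧ ∀ r ∈ IsLocalRing.maximalIdeal R, r • x = 0 := by
  obtain ⟨p, hp⟩ := associatedPrimes.nonempty R N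
  obtain ⟨hp, x, rfl⟩ := isAssociatedPrime_iff.mp hp
  have hm := IsLocalRing.eq_maximalIdeal (IsArtinianRing.isMaximal_of_isPrime
    (Submodule.colon (⊥ : Submodule R N) {x}))
  refine ⟨x, ?_, fun r hr => ?_⟩
  · rintro rfl
    exact hp.ne_top (by ext; simp [Submodule.mem_colon_singleton])
  · rwa [← hm, Submodule.mem_colon_singleton] at hr

theorem IsMinimalCover.injective_of_free_ker {F M : Type*} [AddCommGroup F] [Module R F]
    [AddCommGroup M] [Module R M] {f : F →ₗ[R] M} (hf : IsMinimalCover f)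
    [Module.Free R (LinearMap.ker f)] : Function.Injective f := by
  obtain ⟨s, hs, hms⟩ := exists_ne_zero_maximalIdeal_smul_eq_zero (R := R) R
  have hmF : IsLocalRing.maximalIdeal R • ⊤ ≤ LinearMap.ker (LinearMap.lsmul R F s) := by
    rw [Submodule.smul_le]
    intro r hr x _
    rw [LinearMap.mem_ker, LinearMap.lsmul_apply, smul_smul, mul_comm, ← smul_eq_mul, hms r hr,
      zero_smul]
  rw [← LinearMap.ker_eq_bot, ← Submodule.subsingleton_iff_eq_bot]
  by_contra hker
  rw [not_subsingleton_iff_nontrivial] at hker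
  refine hs (eq_of_smul_eq_smul (α := LinearMap.ker f) fun x => ?_)
  rw [zero_smul]
  exact Subtype.ext (hmF (hf.ker_le x.2))

variable {M : Type u} [AddCommGroup M] [Module R M] [Module.Finite R M]

theorem free_of_bettiNumber_le_one (hM : Module.length R R ∣ Module.length R M) (n : ℕ)
    (hn : bettiNumber R M n ≤ 1) : Module.Free R M := by
  obtain ⟨b, f, hf⟩ := exists_isMinimalCover (R := R) M
  induction n generalizing M b with
  | zero =>
    rw [hf.bettiNumber_zero] at hn
    rcases subsingleton_or_nontrivial M with _ | _
    · exact Module.Free.of_subsingleton R M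
    refine free_of_surjective_of_length_le hf.surjective ?_
    obtain ⟨c, hc⟩ := hM
    have hc₀ : c ≠ 0 := fun h =>
      (Module.length_pos (R := R) (M := M)).ne' (by rw [hc, h, mul_zero])
    calc b * Module.length R R ≤ 1 * Module.length R R := by gcongr; exact_mod_cast hn
      _ = Module.length R R * 1 := mul_comm _ _
      _ ≤ Module.length R M := by rw [hc]; gcongr; exact Order.one_le_iff_ne_zero.mpr hc₀
  | succ n ih =>
    rw [hf.bettiNumber_succ] at hn
    have hker : Module.length R R ∣ Module.length R (LinearMap.ker f) :=
      enat_dvd_of_add_eq_natCast_mul Module.length_pos.ne' Module.length_ne_top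
        (length_ker_add_length hf.surjective) hM
    obtain ⟨_, _, hg⟩ := exists_isMinimalCover (R := R) (LinearMap.ker f)
    have := ih hker hn _ _ hg
    exact Module.Free.of_equiv
      (LinearEquiv.ofBijective f ⟨hf.injective_of_free_ker, hf.surjective⟩)

theorem two_le_bettiNumber (hfree : ¬ Module.Free R M)
    (hM : Module.length R R ∣ Module.length R M) (n : ℕ) : 2 ≤ bettiNumber R M n := by
  by_contra! h
  exact hfree (free_of_bettiNumber_le_one hM n (Nat.lt_succ_iff.mp h))

theorem bettiNumber_zero_le_bettiNumber_one (hfree : ¬ Module.Free R M)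
    (hM : Module.length R M = Module.length R R) : bettiNumber R M 0 ≤ bettiNumber R M 1 := by
  obtain ⟨b, f, hf⟩ := exists_isMinimalCover (R := R) M
  obtain ⟨c, g, hg⟩ := exists_isMinimalCover (R := R) (LinearMap.ker f)
  rw [hf.bettiNumber_zero, hf.bettiNumber_succ, hg.bettiNumber_zero]
  by_contra! hcb
  have hlength : c * Module.length R R + Module.length R R ≤
      Module.length R (LinearMap.ker f) + Module.length R R := by
    calc c * Module.length R R + Module.length R R = ((c + 1 : ℕ) : ℕ∞) * Module.length R R := by
          push_cast; ring
      _ ≤ b * Module.length R R := by gcongr; exact hcb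
      _ = Module.length R (LinearMap.ker f) + Module.length R R := by
          rw [← length_ker_add_length hf.surjective, hM]
  have := free_of_surjective_of_length_le hg.surjective
    ((ENat.add_le_add_iff_right Module.length_ne_top).mp hlength)
  exact hfree (Module.Free.of_equiv
    (LinearEquiv.ofBijective f ⟨hf.injective_of_free_ker, hf.surjective⟩))

end Artinian

section ResidueFieldMaps

variable {R N : Type*} [CommRing R] [IsLocalRing R] [AddCommGroup N] [Module R N]

theorem exists_injective_linearMap_residueField {x : N} (hx₀ : x ≠ 0)
    (hx : ∀ r ∈ IsLocalRing.maximalIdeal R, r • x = 0) :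
    ∃ g : IsLocalRing.ResidueField R →ₗ[R] N, g 1 = x ∧ Function.Injective g := by
  let g : IsLocalRing.ResidueField R →ₗ[R] N :=
    (IsLocalRing.maximalIdeal R).liftQ (LinearMap.toSpanSingleton R N x) fun r hr => hx r hr
  have hg : g 1 = x := one_smul R x
  refine ⟨g, hg, (LinearMap.injective_or_eq_zero g).resolve_right fun h => hx₀ ?_⟩
  rw [← hg, h, LinearMap.zero_apply]

theorem isTorsionBySet_residueField_linearMap :
    Module.IsTorsionBySet R (IsLocalRing.ResidueField R →ₗ[R] N)
      (IsLocalRing.maximalIdeal R : Set R) := fun g r => by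
  ext x
  change (r : R) • g x = 0
  rw [← map_smul, @isTorsionBySet_residueField R _ _ x r, map_zero]

theorem linearMap_residueField_apply_residue (g : IsLocalRing.ResidueField R →ₗ[R] N) (r : R) :
    g (IsLocalRing.residue R r) = r • g 1 := by
  rw [← map_smul, Algebra.smul_def, mul_one, IsLocalRing.ResidueField.algebraMap_eq]

theorem length_linearMap_le_length {Q : Type*} [AddCommGroup Q] [Module R Q]
    (hQ : Module.length R (IsLocalRing.ResidueField R →ₗ[R] Q) ≤ 1) (hN : IsFiniteLength R N) :
    Module.length R (N →ₗ[R] Q) ≤ Module.length R N := by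
  induction hN with
  | of_subsingleton => simp
  | @of_simple_quotient M _ _ P hP _ ih =>
    obtain ⟨e⟩ := nonempty_residueField_equiv (R := R) (M ⧸ P)
    calc Module.length R (M →ₗ[R] Q)
        ≤ Module.length R ((M ⧸ P) →ₗ[R] Q) + Module.length R (P →ₗ[R] Q) :=
          length_le_add_of_exact (LinearMap.exact_lcomp_of_exact_of_surjective Q
            (LinearMap.exact_subtype_mkQ P) P.mkQ_surjective)
      _ = Module.length R (IsLocalRing.ResidueField R →ₗ[R] Q) + Module.length R (P →ₗ[R] Q) := by
          rw [(e.congrLeft Q R).length_eq]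
      _ ≤ 1 + Module.length R P := add_le_add hQ ih
      _ = Module.length R M := by
          rw [Module.length_eq_add_of_exact P.subtype P.mkQ P.subtype_injective P.mkQ_surjective
            (LinearMap.exact_subtype_mkQ P), Module.length_eq_one R (M ⧸ P), add_comm]

end ResidueFieldMaps

section DualizingModule

variable (R : Type*) [CommRing R] [IsLocalRing R]

/-- A dualizing module of an Artinian local ring `R` with residue field `k`, which is the injective
hull of `k`. It is encoded as an injective module `E` such that `Hom(k, E)` has length one. -/
structure IsDualizingModule (E : Type*) [AddCommGroup E] [Module R E] : Prop where
  injective : Module.Injective R E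
  length_linearMap : Module.length R (IsLocalRing.ResidueField R →ₗ[R] E) = 1

variable {R}

theorem injective_of_comp_eq_id {R : Type u} {E J : Type v} [Ring R] [AddCommGroup E]
    [Module R E] [AddCommGroup J] [Module R J] [Small.{v} R] [Module.Injective R J]
    {i : E →ₗ[R] J} {p : J →ₗ[R] E} (h : p ∘ₗ i = LinearMap.id) :
    Module.Injective R E where
  out X Y _ _ _ _ f hf g := by
    obtain ⟨φ, hφ⟩ := Module.Injective.extension_property R J X Y f hf (i ∘ₗ g)
    refine ⟨p ∘ₗ φ, fun x => ?_⟩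
    calc p (φ (f x)) = p (i (g x)) := congrArg p (LinearMap.congr_fun hφ x)
      _ = g x := LinearMap.congr_fun h (g x)

theorem injective_linearMap_of_fin {R E : Type u} [CommRing R] [AddCommGroup E] [Module R E]
    [Module.Injective R E] (b : ℕ) : Module.Injective R ((Fin b → R) →ₗ[R] E) := by
  let e := (Pi.basisFun R (Fin b)).constr R (M' := E)
  exact injective_of_comp_eq_id (i := e.symm.toLinearMap) (p := e.toLinearMap)
    (LinearMap.ext e.apply_symm_apply)

theorem exists_submodule_forall_mkQ_mem {R J : Type*} [Ring R] [AddCommGroup J] [Module R J]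
    {x : J} (hx : x ≠ 0) :
    ∃ C : Submodule R J, x ∉ C ∧ ∀ P : Submodule R (J ⧸ C), P ≠ ⊥ → C.mkQ x ∈ P := by
  obtain ⟨C, -, hC⟩ := zorn_le_nonempty₀ {C : Submodule R J | x ∉ C}
    (fun c hc hchain y hy => ⟨sSup c, fun hxc => by
      obtain ⟨D, hD, hxD⟩ := (Submodule.mem_sSup_of_directed ⟨y, hy⟩ hchain.directedOn).mp hxc
      exact hc hD hxD, fun _ => le_sSup⟩) ⊥ (by simpa using hx)
  refine ⟨C, hC.prop, fun P hP => ?_⟩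
  by_contra hxP
  have hCP : P.comap C.mkQ = C := (hC.eq_of_le hxP (C.le_comap_mkQ P)).symm
  refine hP (le_bot_iff.mp ?_)
  rw [← Submodule.map_comap_eq_of_surjective C.mkQ_surjective P, hCP, Submodule.mkQ_map_self]

theorem isSimpleModule_residueField_linearMap_of_forall_mem {E : Type*} [AddCommGroup E]
    [Module R E] {e : E} (he₀ : e ≠ 0) (he : ∀ P : Submodule R E, P ≠ ⊥ → e ∈ P)
    [Nontrivial (IsLocalRing.ResidueField R →ₗ[R] E)] :
    IsSimpleModule R (IsLocalRing.ResidueField R →ₗ[R] E) := by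
  have hsmul : ∀ g : IsLocalRing.ResidueField R →ₗ[R] E, g ≠ 0 → ∃ a : R, a • g 1 = e := by
    intro g hg
    obtain ⟨y, hy⟩ := he (LinearMap.range g) (mt LinearMap.range_eq_bot.mp hg)
    obtain ⟨a, rfl⟩ := IsLocalRing.residue_surjective y
    exact ⟨a, (linearMap_residueField_apply_residue g a).symm.trans hy⟩
  rw [isSimpleModule_iff_toSpanSingleton_surjective]
  refine ⟨inferInstance, fun g hg h => ?_⟩
  rcases eq_or_ne h 0 with rfl | hh
  · exact ⟨0, map_zero _⟩
  obtain ⟨a, ha⟩ := hsmul g hg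
  obtain ⟨b, hb⟩ := hsmul h hh
  have hbm : b ∉ IsLocalRing.maximalIdeal R := fun hbm => he₀ <| by
    rw [← hb, ← LinearMap.smul_apply, @isTorsionBySet_residueField_linearMap R E _ _ _ _ h ⟨b, hbm⟩,
      LinearMap.zero_apply]
  obtain ⟨u, rfl⟩ := IsLocalRing.notMem_maximalIdeal.mp hbm
  refine ⟨↑u⁻¹ * a, LinearMap.ext fun y => ?_⟩
  obtain ⟨r, rfl⟩ := IsLocalRing.residue_surjective y
  rw [linearMap_residueField_apply_residue, linearMap_residueField_apply_residue,
    LinearMap.toSpanSingleton_apply, LinearMap.smul_apply, mul_smul, ha, ← hb,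
    smul_smul (↑u⁻¹ : R), Units.inv_mul, one_smul]

theorem length_le_length_self_of_length_linearMap_le_one {R E : Type*} [CommRing R]
    [IsArtinianRing R] [IsLocalRing R] [AddCommGroup E] [Module R E]
    (hE : Module.length R (IsLocalRing.ResidueField R →ₗ[R] E) ≤ 1) :
    Module.length R E ≤ Module.length R R := by
  rw [← (LinearMap.ringLmapEquivSelf R R E).length_eq]
  exact length_linearMap_le_length hE (Module.length_ne_top_iff.mp Module.length_ne_top)

theorem exists_isDualizingModule (R : Type u) [CommRing R] [IsArtinianRing R] [IsLocalRing R] :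
    ∃ E : ModuleCat.{u} R, IsDualizingModule R E := by
  let J := Injective.under (residueModule R)
  let ι : IsLocalRing.ResidueField R →ₗ[R] J := (Injective.ι (residueModule R)).hom
  have hι : Function.Injective ι := (ModuleCat.mono_iff_injective _).mp inferInstance
  have : Injective (ModuleCat.of R J) := Injective.injective_under (residueModule R)
  have := Module.injective_module_of_injective_object R J
  obtain ⟨C, hxC, he⟩ := exists_submodule_forall_mkQ_mem (R := R)
    ((map_ne_zero_iff ι hι).mpr one_ne_zero : ι 1 ≠ 0)
  have he₀ : C.mkQ (ι 1) ≠ 0 := by simpa using hxC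
  have hg₀ : C.mkQ ∘ₗ ι ≠ 0 := fun h => he₀ (LinearMap.congr_fun h 1)
  have : Nontrivial (IsLocalRing.ResidueField R →ₗ[R] J ⧸ C) := nontrivial_of_ne _ _ hg₀
  have hsimple := isSimpleModule_residueField_linearMap_of_forall_mem he₀ he
  have hlength := Module.length_eq_one_iff.mpr hsimple
  obtain ⟨_, _⟩ := isFiniteLength_iff_isNoetherian_isArtinian.mp <| Module.length_ne_top_iff.mp <|
    ne_top_of_le_ne_top Module.length_ne_top
      (length_le_length_self_of_length_linearMap_le_one hlength.le)
  obtain ⟨φ, hφ⟩ := Module.Injective.extension_property R J _ _ (C.mkQ ∘ₗ ι)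
    ((LinearMap.injective_or_eq_zero _).resolve_right hg₀) ι
  have hinj : Function.Injective (C.mkQ ∘ₗ φ) := by
    rw [← LinearMap.ker_eq_bot]
    by_contra hker
    exact he₀ ((congrArg C.mkQ (LinearMap.congr_fun hφ 1)).symm.trans (he _ hker))
  let σ := LinearEquiv.ofBijective (C.mkQ ∘ₗ φ)
    ⟨hinj, IsArtinian.surjective_of_injective_endomorphism _ hinj⟩
  -- `φ` embeds `J ⧸ C` in `J` as a section of the projection, up to the automorphism `σ`.
  refine ⟨ModuleCat.of R (J ⧸ C), ?_, hlength⟩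
  exact injective_of_comp_eq_id (i := φ ∘ₗ σ.symm.toLinearMap) (p := C.mkQ)
    (LinearMap.ext σ.apply_symm_apply)

namespace IsDualizingModule

variable {R : Type u} [CommRing R] [IsLocalRing R] {E : Type u} [AddCommGroup E] [Module R E]

theorem nonempty_linearMap_residueField_equiv (hE : IsDualizingModule R E) :
    Nonempty ((IsLocalRing.ResidueField R →ₗ[R] E) ≃ₗ[R] IsLocalRing.ResidueField R) :=
  have := Module.length_eq_one_iff.mp hE.length_linearMap
  nonempty_residueField_equiv _

section Artinian

variable [IsArtinianRing R]

theorem injective_lsmul (hE : IsDualizingModule R E) :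
    Function.Injective (LinearMap.lsmul R E) := by
  have := hE.injective
  rw [injective_iff_map_eq_zero]
  intro r hr
  by_contra hr₀
  have : Nontrivial (Ideal.span {r}) :=
    Submodule.nontrivial_iff_ne_bot.mpr (mt Ideal.span_singleton_eq_bot.mp hr₀)
  obtain ⟨⟨s, hs⟩, hs₀, hms⟩ := exists_ne_zero_maximalIdeal_smul_eq_zero (R := R) (Ideal.span {r})
  obtain ⟨a, rfl⟩ := Ideal.mem_span_singleton'.mp hs
  obtain ⟨ι, hι₁, hι⟩ := exists_injective_linearMap_residueField
    (fun h => hs₀ (Subtype.ext h)) fun t ht => congrArg Subtype.val (hms t ht)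
  obtain ⟨σ⟩ := hE.nonempty_linearMap_residueField_equiv
  obtain ⟨φ, hφ⟩ := Module.Injective.extension_property R E _ _ ι hι (σ.symm 1)
  have hσ₁ : σ.symm 1 1 = 0 := calc
    σ.symm 1 1 = φ (a * r) := by rw [← hφ, LinearMap.comp_apply, hι₁]
    _ = a • (LinearMap.lsmul R E r) (φ 1) := by
      rw [LinearMap.lsmul_apply, ← map_smul, ← map_smul, smul_eq_mul, smul_eq_mul, mul_one]
    _ = 0 := by rw [hr, LinearMap.zero_apply, smul_zero]
  have hσ : σ.symm 1 = 0 := by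
    ext y
    obtain ⟨t, rfl⟩ := IsLocalRing.residue_surjective y
    rw [linearMap_residueField_apply_residue, hσ₁, smul_zero, LinearMap.zero_apply]
  exact one_ne_zero (σ.symm.map_eq_zero_iff.mp hσ)

theorem length_eq (hE : IsDualizingModule R E) : Module.length R E = Module.length R R := by
  have hle := length_le_length_self_of_length_linearMap_le_one hE.length_linearMap.le
  refine le_antisymm hle ?_
  calc Module.length R R ≤ Module.length R (E →ₗ[R] E) :=
        Module.length_le_of_injective _ hE.injective_lsmul
    _ ≤ Module.length R E := length_linearMap_le_length hE.length_linearMap.le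
        (Module.length_ne_top_iff.mp (ne_top_of_le_ne_top Module.length_ne_top hle))

protected theorem finite (hE : IsDualizingModule R E) : Module.Finite R E := by
  have := (isFiniteLength_iff_isNoetherian_isArtinian.mp
    (Module.length_ne_top_iff.mp (hE.length_eq.trans_ne Module.length_ne_top))).1
  infer_instance

theorem nonempty_linearEquiv_end (hE : IsDualizingModule R E) :
    Nonempty (R ≃ₗ[R] (E →ₗ[R] E)) := by
  have hle : Module.length R (E →ₗ[R] E) ≤ Module.length R R :=
    hE.length_eq ▸ length_linearMap_le_length hE.length_linearMap.le
      (Module.length_ne_top_iff.mp (hE.length_eq.trans_ne Module.length_ne_top))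
  exact ⟨LinearEquiv.ofBijective (LinearMap.lsmul R E) ⟨hE.injective_lsmul,
    surjective_of_injective_of_length_le hE.injective_lsmul hle Module.length_ne_top⟩⟩

end Artinian

theorem length_ext_linearMap_succ (hE : IsDualizingModule R E) {N : Type u} [AddCommGroup N]
    [Module R N] {b : ℕ} {f : (Fin b → R) →ₗ[R] N} (hf : IsMinimalCover f) (n : ℕ) :
    Module.length R (Abelian.Ext (residueModule R) (ModuleCat.of R (N →ₗ[R] E)) (n + 1)) =
      Module.length R
        (Abelian.Ext (residueModule R) (ModuleCat.of R (LinearMap.ker f →ₗ[R] E)) n) := by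
  have := hE.injective
  have hexact := LinearMap.exact_lcomp_of_exact_of_surjective E
    (LinearMap.exact_subtype_ker_map f) hf.surjective
  let S : ShortComplex (ModuleCat.{u} R) :=
    ModuleCat.shortComplexOfCompEqZero _ _ hexact.linearMap_comp_eq_zero
  have hS : S.ShortExact := ModuleCat.shortComplex_shortExact S hexact
    (LinearMap.lcomp_injective_of_surjective f hf.surjective) fun g =>
      Module.Injective.extension_property R E _ _ _ (Submodule.subtype_injective _) g
  have := injective_linearMap_of_fin (R := R) (E := E) b
  have : Injective S.X₂ := Module.injective_object_of_injective_module R ((Fin b → R) →ₗ[R] E)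
  refine length_ext_succ_of_injective hS _ (fun g => ?_) n
  ext y x
  exact LinearMap.congr_fun (map_eq_zero_of_mem_smul_top isTorsionBySet_residueField_linearMap
    (LinearMap.flip g.hom) (hf.ker_le x.2)) y

theorem length_ext_linearMap [IsNoetherianRing R] (hE : IsDualizingModule R E) (N : Type u)
    [AddCommGroup N] [Module R N] [Module.Finite R N] (n : ℕ) :
    Module.length R (Abelian.Ext (residueModule R) (ModuleCat.of R (N →ₗ[R] E)) n) =
      Module.length R (Abelian.Ext (ModuleCat.of R N) (residueModule R) n) := by
  induction n generalizing N with
  | zero =>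
    obtain ⟨σ⟩ := hE.nonempty_linearMap_residueField_equiv
    rw [length_ext_zero, length_ext_zero]
    exact (LinearMap.lflip.trans (σ.congrRight : (N →ₗ[R] _) ≃ₗ[R] _)).length_eq
  | succ n ih =>
    obtain ⟨b, f, hf⟩ := exists_isMinimalCover (R := R) N
    rw [hE.length_ext_linearMap_succ hf, hf.length_ext_succ, ih]

theorem bassNumber_eq_bettiNumber [IsArtinianRing R] (hE : IsDualizingModule R E) (n : ℕ) :
    bassNumber R n = bettiNumber R E n := by
  have := hE.finite
  obtain ⟨e⟩ := hE.nonempty_linearEquiv_end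
  rw [bassNumber_eq_toNat_length, bettiNumber_eq_toNat_length, ← hE.length_ext_linearMap,
    length_ext_congr_right _ e.toModuleIso]

end IsDualizingModule

theorem injective_self_of_bassNumber_eq_one {R : Type u} [CommRing R] [IsArtinianRing R]
    [IsLocalRing R] {n : ℕ} (hn : bassNumber R n = 1) : Module.Injective R R := by
  obtain ⟨E, hE⟩ := exists_isDualizingModule R
  have := hE.finite
  have := hE.injective
  have : Module.Free R E := free_of_bettiNumber_le_one hE.length_eq.symm.dvd n
    ((hE.bassNumber_eq_bettiNumber n).symm.trans hn).le
  have : Nontrivial E := by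
    rw [← Module.length_pos_iff (R := R), hE.length_eq]
    exact Module.length_pos
  let B := Module.Free.chooseBasis R E
  obtain ⟨i⟩ := B.index_nonempty
  exact injective_of_comp_eq_id (i := LinearMap.toSpanSingleton R E (B i)) (p := B.coord i)
    (LinearMap.ext_ring (by simp))

theorem bassNumber_succ_of_injective {R : Type u} [CommRing R] [IsLocalRing R]
    [Module.Injective R R] (n : ℕ) : bassNumber R (n + 1) = 0 := by
  have := Module.injective_object_of_injective_module R R
  have := Abelian.Ext.subsingleton_of_injective (residueModule R) (ModuleCat.of R R) n
  rw [bassNumber_eq_toNat_length, Module.length_eq_zero, ENat.toNat_zero]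

end DualizingModule

section ExtensionComparison

variable {C : Type*} [Category* C] [Abelian C] [HasExt.{u} C]
  {D : Type*} [Category* D] [Abelian D] [HasExt.{v} D]
  (F : C ⥤ D) [F.Additive] [Limits.PreservesFiniteLimits F] [Limits.PreservesFiniteColimits F]
  {Z : C} {Y : D} (ε : Abelian.Ext (F.obj Z) Y 1)

/-- The map `Ext^n(N, Z) → Ext^(n+1)(F N, Y)` applying the exact functor `F` and then composing
with a fixed extension class `ε` of `F Z` by `Y`; it is the comparison map in Rees' theorem. -/
noncomputable def extMapComp (N : C) (n : ℕ) :
    Abelian.Ext N Z n →+ Abelian.Ext (F.obj N) Y (n + 1) where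
  toFun e := (e.mapExactFunctor F).comp ε rfl
  map_zero' := by rw [Abelian.Ext.mapExactFunctor_zero, Abelian.Ext.zero_comp]
  map_add' e e' := by rw [Abelian.Ext.mapExactFunctor_add, Abelian.Ext.add_comp]

theorem extMapComp_apply {N : C} {n : ℕ} (e : Abelian.Ext N Z n) :
    extMapComp F ε N n e = (e.mapExactFunctor F).comp ε rfl := rfl

theorem extMapComp_comp {M N : C} {m n k : ℕ} (a : Abelian.Ext M N m) (e : Abelian.Ext N Z n)
    (h : m + n = k) : extMapComp F ε M k (a.comp e h) =
      (a.mapExactFunctor F).comp (extMapComp F ε N n e) (by omega) := by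
  rw [extMapComp_apply, extMapComp_apply, Abelian.Ext.mapExactFunctor_comp,
    Abelian.Ext.comp_assoc _ _ _ h rfl (by omega)]

theorem extMapComp_bijective [EnoughProjectives C]
    (hzero : ∀ N, Function.Bijective (extMapComp F ε N 0))
    (hproj : ∀ (P : C) [Projective P] (n : ℕ), Subsingleton (Abelian.Ext (F.obj P) Y (n + 2)))
    (N : C) (n : ℕ) : Function.Bijective (extMapComp F ε N n) := by
  induction n generalizing N with
  | zero => exact hzero N
  | succ n ih =>
    let P : ProjectivePresentation N := Classical.arbitrary _
    let S := ShortComplex.mk _ _ (Limits.kernel.condition P.f)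
    have hS : S.ShortExact := { exact := ShortComplex.exact_kernel P.f }
    have hSF := hS.map_of_exact F
    have : Projective S.X₂ := P.projective
    exact AddMonoidHom.bijective_of_surjective_of_bijective_of_right_exact _ _ _ _
      (extMapComp F ε S.X₂ n) (extMapComp F ε S.X₁ n) (extMapComp F ε S.X₃ (n + 1))
      (AddMonoidHom.ext fun e => by
        simpa [Abelian.Ext.mapExactFunctor_mk₀] using!
          (extMapComp_comp F ε (.mk₀ S.f) e (zero_add n)).symm)
      (AddMonoidHom.ext fun e => by
        simpa [Abelian.Ext.mapExactFunctor_extClass] using!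
          (extMapComp_comp F ε hS.extClass e (add_comm 1 n)).symm)
      ((ShortComplex.ab_exact_iff_function_exact _).1
        (Abelian.Ext.contravariant_sequence_exact₁' hS Z n (n + 1) (add_comm 1 n)))
      ((ShortComplex.ab_exact_iff_function_exact _).1
        (Abelian.Ext.contravariant_sequence_exact₁' hSF Y (n + 1) (n + 2) (add_comm 1 _)))
      (ih _).surjective (ih _)
      (fun e => Abelian.Ext.contravariant_sequence_exact₃ hS _ e
        (Abelian.Ext.eq_zero_of_projective _) (add_comm 1 n))
      (fun e => Abelian.Ext.contravariant_sequence_exact₃ hSF _ e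
        ((hproj S.X₂ n).elim _ _) (add_comm 1 (n + 1)))

end ExtensionComparison

section Rees

variable {R : Type u} [CommRing R]

/-- Restriction of scalars from `R ⧸ (x)`-modules to `R`-modules. -/
noncomputable abbrev quotientRestrictScalars (x : R) :
    ModuleCat.{u} (R ⧸ Ideal.span {x}) ⥤ ModuleCat.{u} R :=
  ModuleCat.restrictScalars (Ideal.Quotient.mk (Ideal.span {x}))

instance quotientRestrictScalars_full (x : R) : (quotientRestrictScalars x).Full where
  map_surjective {M N} g := by
    refine ⟨ModuleCat.ofHom
      { toFun := fun y => g.hom y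
        map_add' := fun y z => g.hom.map_add y z
        map_smul' := fun r y => ?_ }, rfl⟩
    obtain ⟨r, rfl⟩ := Ideal.Quotient.mk_surjective r
    exact g.hom.map_smul r y

theorem smul_quotientRestrictScalars_eq_zero {x : R} (N : ModuleCat.{u} (R ⧸ Ideal.span {x}))
    (y : (quotientRestrictScalars x).obj N) : x • y = 0 := by
  change (Ideal.Quotient.mk (Ideal.span {x}) x • (show N from y) : N) = 0
  rw [Ideal.Quotient.eq_zero_iff_mem.mpr (Ideal.mem_span_singleton_self x), zero_smul]

theorem exists_iso_quotientRestrictScalars {x : R} (N : ModuleCat.{u} R)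
    (hN : ∀ y : N, x • y = 0) : ∃ N' : ModuleCat.{u} (R ⧸ Ideal.span {x}),
      Nonempty ((quotientRestrictScalars x).obj N' ≅ N) := by
  let := ((Module.isTorsionBySet_span_singleton_iff x).mpr (fun y => hN y)).module
  exact ⟨ModuleCat.of _ N,
    ⟨LinearEquiv.toModuleIso { AddEquiv.refl N with map_smul' := fun _ _ => rfl }⟩⟩

/-- Restricting scalars on `M ⧸ x M`, viewed as a module over `R ⧸ (x)`, recovers the `R`-module
`M ⧸ x M`. -/
noncomputable def quotientRestrictScalarsIso (x : R) (M : ModuleCat.{u} R) :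
    (quotientRestrictScalars x).obj (ModuleCat.of (R ⧸ Ideal.span {x}) (QuotSMulTop x M)) ≅
      (M.smulShortComplex x).X₃ :=
  LinearEquiv.toModuleIso
    { AddEquiv.refl (QuotSMulTop x M) with
      map_smul' := fun r y => algebraMap_smul (R ⧸ Ideal.span {x}) r (show QuotSMulTop x M from y) }

variable {x : R} {M : ModuleCat.{u} R}

/-- The class in `Ext¹_R(M ⧸ x M, M)` of `0 → M → M → M ⧸ x M → 0`, where the first map is
multiplication by the `M`-regular element `x`. -/
noncomputable def smulExtClass (hM : IsSMulRegular M x) : Abelian.Ext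
    ((quotientRestrictScalars x).obj (ModuleCat.of (R ⧸ Ideal.span {x}) (QuotSMulTop x M))) M 1 :=
  (Abelian.Ext.mk₀ (quotientRestrictScalarsIso x M).hom).comp
    hM.smulShortComplex_shortExact.extClass (zero_add 1)

theorem extMapComp_smulExtClass_mk₀ (hM : IsSMulRegular M x)
    {N : ModuleCat.{u} (R ⧸ Ideal.span {x})}
    (g : N ⟶ ModuleCat.of (R ⧸ Ideal.span {x}) (QuotSMulTop x M)) :
    extMapComp (quotientRestrictScalars x) (smulExtClass hM) N 0 (Abelian.Ext.mk₀ g) =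
      (Abelian.Ext.mk₀ ((quotientRestrictScalars x).map g ≫
        (quotientRestrictScalarsIso x M).hom)).comp
          hM.smulShortComplex_shortExact.extClass rfl := by
  rw [extMapComp_apply, Abelian.Ext.mapExactFunctor_mk₀]
  exact Abelian.Ext.mk₀_comp_mk₀_assoc _ _ _

theorem extMapComp_smulExtClass_zero_injective (hM : IsSMulRegular M x)
    (N : ModuleCat.{u} (R ⧸ Ideal.span {x})) :
    Function.Injective (extMapComp (quotientRestrictScalars x) (smulExtClass hM) N 0) := by
  rw [injective_iff_map_eq_zero]
  intro e he
  obtain ⟨g, rfl⟩ := (Abelian.Ext.mk₀_bijective _ _).2 e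
  rw [extMapComp_smulExtClass_mk₀] at he
  obtain ⟨h, hh⟩ := Abelian.Ext.covariant_sequence_exact₃ _
    hM.smulShortComplex_shortExact _ rfl he
  obtain ⟨h, rfl⟩ := (Abelian.Ext.mk₀_bijective _ _).2 h
  have h_zero : h = 0 := by
    ext y
    refine hM.right_eq_zero_of_smul ?_
    change x • h.hom y = 0
    rw [← map_smul, smul_quotientRestrictScalars_eq_zero, map_zero]
  have hg : (quotientRestrictScalars x).map g = 0 := by
    rw [h_zero, Abelian.Ext.mk₀_zero, Abelian.Ext.zero_comp, eq_comm,
      Abelian.Ext.mk₀_eq_zero_iff] at hh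
    exact (Preadditive.IsIso.comp_right_eq_zero _ _).mp hh
  rw [(quotientRestrictScalars x).map_injective (hg.trans (Functor.map_zero _ _ _).symm),
    Abelian.Ext.mk₀_zero]

theorem smul_ext_quotientRestrictScalars_eq_zero {N : ModuleCat.{u} (R ⧸ Ideal.span {x})} {n : ℕ}
    (y : Abelian.Ext ((quotientRestrictScalars x).obj N) M n) : x • y = 0 := by
  have h : x • 𝟙 ((quotientRestrictScalars x).obj N) = 0 := by
    ext z
    exact smul_quotientRestrictScalars_eq_zero N z
  rw [← Abelian.Ext.mk₀_id_comp y, ← Abelian.Ext.smul_comp, ← Abelian.Ext.mk₀_smul, h,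
    Abelian.Ext.mk₀_zero, Abelian.Ext.zero_comp]

theorem extMapComp_smulExtClass_zero_surjective (hM : IsSMulRegular M x)
    (N : ModuleCat.{u} (R ⧸ Ideal.span {x})) :
    Function.Surjective (extMapComp (quotientRestrictScalars x) (smulExtClass hM) N 0) := by
  intro y
  have hxy : x • y = 0 := smul_ext_quotientRestrictScalars_eq_zero y
  rw [Abelian.Ext.smul_eq_comp_mk₀] at hxy
  obtain ⟨z, rfl⟩ := Abelian.Ext.covariant_sequence_exact₁ _
    hM.smulShortComplex_shortExact y hxy rfl
  obtain ⟨z, rfl⟩ := (Abelian.Ext.mk₀_bijective _ _).2 z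
  obtain ⟨g, hg⟩ :=
    (quotientRestrictScalars x).map_surjective (z ≫ (quotientRestrictScalarsIso x M).inv)
  exact ⟨Abelian.Ext.mk₀ g, by rw [extMapComp_smulExtClass_mk₀, hg, Category.assoc,
    Iso.inv_hom_id, Category.comp_id]⟩

theorem hasProjectiveDimensionLT_quotSMulTop (hM : IsSMulRegular M x) [Projective M] :
    HasProjectiveDimensionLT ((quotientRestrictScalars x).obj
      (ModuleCat.of (R ⧸ Ideal.span {x}) (QuotSMulTop x M))) 2 := by
  have := hM.smulShortComplex_shortExact.hasProjectiveDimensionLT_X₃ 1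
    (inferInstanceAs (HasProjectiveDimensionLT M 1))
    (inferInstanceAs (HasProjectiveDimensionLT M 2))
  exact hasProjectiveDimensionLT_of_iso (quotientRestrictScalarsIso x M).symm 2

theorem hasProjectiveDimensionLT_quotientRestrictScalars (hx : IsSMulRegular R x)
    (P : ModuleCat.{u} (R ⧸ Ideal.span {x})) [Projective P] :
    HasProjectiveDimensionLT ((quotientRestrictScalars x).obj P) 2 := by
  -- A free `R`-module `L` covering `P` makes `P` a retract of `L ⧸ x L`.
  let F := quotientRestrictScalars x
  let L := ModuleCat.of R (F.obj P →₀ R)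
  have hL : IsSMulRegular L x := hx.finsupp
  let f : (F.obj P →₀ R) →ₗ[R] F.obj P := Finsupp.linearCombination R id
  let q : (L.smulShortComplex x).X₂ ⟶ _ := ModuleCat.ofHom f
  have : Epi q := (ModuleCat.epi_iff_surjective q).mpr
    (Finsupp.linearCombination_id_surjective R (F.obj P))
  have hxq : (L.smulShortComplex x).f ≫ q = 0 := by
    ext y
    exact (q.hom.map_smul x _).trans (smul_quotientRestrictScalars_eq_zero P _)
  obtain ⟨g, hg⟩ := F.map_surjective ((quotientRestrictScalarsIso x L).hom ≫
    hL.smulShortComplex_shortExact.exact.desc q hxq)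
  have : Epi (hL.smulShortComplex_shortExact.exact.desc q hxq) :=
    epi_of_epi_fac (hL.smulShortComplex_shortExact.exact.g_desc q hxq)
  have : Epi (F.map g) := hg ▸ inferInstance
  have : Epi g := F.epi_of_epi_map this
  let retract : Retract P (ModuleCat.of (R ⧸ Ideal.span {x}) (QuotSMulTop x L)) :=
    ⟨Projective.factorThru (𝟙 P) g, g, Projective.factorThru_comp (𝟙 P) g⟩
  have := hasProjectiveDimensionLT_quotSMulTop hL
  exact (retract.map F).hasProjectiveDimensionLT 2

theorem extMapComp_smulExtClass_bijective (hx : IsSMulRegular R x) (hM : IsSMulRegular M x)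
    (N : ModuleCat.{u} (R ⧸ Ideal.span {x})) (n : ℕ) :
    Function.Bijective (extMapComp (quotientRestrictScalars x) (smulExtClass hM) N n) := by
  refine extMapComp_bijective _ _
    (fun N => ⟨extMapComp_smulExtClass_zero_injective hM N,
      extMapComp_smulExtClass_zero_surjective hM N⟩) (fun P _ n => ?_) N n
  have := hasProjectiveDimensionLT_quotientRestrictScalars hx P
  exact HasProjectiveDimensionLT.subsingleton _ 2 _ (Nat.le_add_left 2 n) _

theorem extMapComp_smulExtClass_smul (hM : IsSMulRegular M x)
    {N : ModuleCat.{u} (R ⧸ Ideal.span {x})} {n : ℕ} (r : R)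
    (e : Abelian.Ext N (ModuleCat.of (R ⧸ Ideal.span {x}) (QuotSMulTop x M)) n) :
    extMapComp (quotientRestrictScalars x) (smulExtClass hM) N n
      (Ideal.Quotient.mk (Ideal.span {x}) r • e) =
      r • extMapComp (quotientRestrictScalars x) (smulExtClass hM) N n e := by
  have h : (quotientRestrictScalars x).map (Ideal.Quotient.mk (Ideal.span {x}) r • 𝟙 N) =
      r • 𝟙 _ := rfl
  rw [← Abelian.Ext.mk₀_id_comp e, ← Abelian.Ext.smul_comp, ← Abelian.Ext.mk₀_smul,
    extMapComp_comp, Abelian.Ext.mapExactFunctor_mk₀, h, Abelian.Ext.mk₀_smul,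
    Abelian.Ext.smul_comp, Abelian.Ext.mk₀_id_comp, Abelian.Ext.mk₀_id_comp]

theorem length_ext_quotientRestrictScalars (hx : IsSMulRegular R x) (hM : IsSMulRegular M x)
    (N : ModuleCat.{u} (R ⧸ Ideal.span {x})) (n : ℕ) :
    Module.length R (Abelian.Ext ((quotientRestrictScalars x).obj N) M (n + 1)) =
      Module.length (R ⧸ Ideal.span {x})
        (Abelian.Ext N (ModuleCat.of (R ⧸ Ideal.span {x}) (QuotSMulTop x M)) n) := by
  let := Module.compHom
    (Abelian.Ext N (ModuleCat.of (R ⧸ Ideal.span {x}) (QuotSMulTop x M)) n)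
    (Ideal.Quotient.mk (Ideal.span {x}))
  have : IsScalarTower R (R ⧸ Ideal.span {x})
      (Abelian.Ext N (ModuleCat.of (R ⧸ Ideal.span {x}) (QuotSMulTop x M)) n) :=
    .of_algebraMap_smul fun _ _ => rfl
  rw [← Module.length_eq_of_surjective (S := R) (R := R ⧸ Ideal.span {x})
    Ideal.Quotient.mk_surjective]
  exact (LinearEquiv.ofBijective
    { extMapComp (quotientRestrictScalars x) (smulExtClass hM) N n with
      map_smul' := extMapComp_smulExtClass_smul hM }
    (extMapComp_smulExtClass_bijective hx hM N n)).length_eq.symm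

end Rees

section InjectiveDimension

theorem injective_of_subsingleton_ext_one {R : Type u} [Ring R] (X : ModuleCat.{u} R)
    (h : ∀ I : Ideal R, Subsingleton (Abelian.Ext (ModuleCat.of R (R ⧸ I)) X 1)) :
    Injective X := by
  suffices hbaer : Module.Baer R X by
    have := hbaer.injective
    exact Module.injective_object_of_injective_module R X
  intro I g
  let S : ShortComplex (ModuleCat.{u} R) :=
    ModuleCat.shortComplexOfCompEqZero I.subtype (Submodule.mkQ I)
      (LinearMap.exact_subtype_mkQ I).linearMap_comp_eq_zero
  have hS : S.ShortExact := ModuleCat.shortComplex_shortExact S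
    (LinearMap.exact_subtype_mkQ I) I.subtype_injective (Submodule.mkQ_surjective I)
  obtain ⟨y, hy⟩ := Abelian.Ext.contravariant_sequence_exact₁ hS X
    (Abelian.Ext.mk₀ (ModuleCat.ofHom g : S.X₁ ⟶ X)) (add_comm 1 0) ((h I).elim _ _)
  obtain ⟨y, rfl⟩ := (Abelian.Ext.mk₀_bijective _ _).2 y
  rw [Abelian.Ext.mk₀_comp_mk₀] at hy
  have hyg := (Abelian.Ext.mk₀_bijective _ _).1 hy
  exact ⟨y.hom, fun r hr => congrArg (fun φ => φ.hom ⟨r, hr⟩) hyg⟩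

theorem hasInjectiveDimensionLT_of_subsingleton_ext {R : Type u} [Ring R] (n : ℕ)
    (X : ModuleCat.{u} R)
    (h : ∀ I : Ideal R, Subsingleton (Abelian.Ext (ModuleCat.of R (R ⧸ I)) X (n + 1))) :
    HasInjectiveDimensionLT X (n + 1) := by
  induction n generalizing X with
  | zero =>
    have := injective_of_subsingleton_ext_one X h
    infer_instance
  | succ n ih =>
    obtain ⟨⟨J, _, f, _⟩⟩ := EnoughInjectives.presentation X
    let S : ShortComplex (ModuleCat.{u} R) := ShortComplex.mk f _ (Limits.cokernel.condition f)
    have hS : S.ShortExact := { exact := ShortComplex.exact_cokernel f }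
    have hJ : Injective S.X₂ := ‹Injective J›
    refine (hS.hasInjectiveDimensionLT_X₃_iff n hJ).mp (ih _ fun I => ?_)
    refine subsingleton_of_forall_eq 0 fun y => ?_
    obtain ⟨w, rfl⟩ := Abelian.Ext.covariant_sequence_exact₃ _ hS y rfl ((h I).elim _ _)
    rw [Abelian.Ext.eq_zero_of_injective w, Abelian.Ext.zero_comp]

end InjectiveDimension

section Vanishing

variable {R : Type u} [CommRing R] {x : R}

theorem isSMulRegular_quotient_of_isPrime {p : Ideal R} [p.IsPrime] (hx : x ∉ p) :
    IsSMulRegular (R ⧸ p) x := by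
  rw [isSMulRegular_iff_right_eq_zero_of_smul]
  intro y hy
  obtain ⟨r, rfl⟩ := Ideal.Quotient.mk_surjective y
  exact Ideal.Quotient.eq_zero_iff_mem.mpr
    ((‹p.IsPrime›.mem_or_mem (Ideal.Quotient.eq_zero_iff_mem.mp hy)).resolve_left hx)

theorem smul_smulShortComplex_X₃_eq_zero (N : ModuleCat.{u} R)
    (y : (N.smulShortComplex x).X₃) : x • y = 0 :=
  have h := Module.isTorsionBy_quotient_element_smul N x
  @h y

variable [IsNoetherianRing R] [IsLocalRing R] (hxm : x ∈ IsLocalRing.maximalIdeal R)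
  {Y : ModuleCat.{u} R} [Module.Finite R Y] {j : ℕ}
include hxm

theorem subsingleton_ext_of_isSMulRegular {N : ModuleCat.{u} R} [Module.Finite R N]
    (hN : IsSMulRegular N x)
    (h : Subsingleton (Abelian.Ext (N.smulShortComplex x).X₃ Y (j + 1))) :
    Subsingleton (Abelian.Ext N Y j) := by
  have hsurj : ∀ y : Abelian.Ext N Y j, ∃ z, y = x • z := fun y => by
    obtain ⟨z, rfl⟩ : ∃ z : Abelian.Ext N Y j,
        (Abelian.Ext.mk₀ (x • 𝟙 N)).comp z (zero_add j) = y :=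
      Abelian.Ext.contravariant_sequence_exact₁ hN.smulShortComplex_shortExact Y y
        (add_comm 1 j) (h.elim _ _)
    exact ⟨z, by rw [Abelian.Ext.mk₀_smul, Abelian.Ext.smul_comp, Abelian.Ext.mk₀_id_comp]⟩
  by_contra hE
  rw [not_subsingleton_iff_nontrivial] at hE
  refine Submodule.top_ne_pointwise_smul_of_mem_jacobson_annihilator
    (IsLocalRing.maximalIdeal_le_jacobson (Module.annihilator R (Abelian.Ext N Y j)) hxm)
    (top_le_iff.mp fun y _ => ?_).symm
  obtain ⟨z, rfl⟩ := hsurj y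
  exact Submodule.smul_mem_pointwise_smul _ _ _ trivial

theorem subsingleton_ext_of_forall_smul_eq_zero
    (h : ∀ N : ModuleCat.{u} R, (∀ y : N, x • y = 0) → Subsingleton (Abelian.Ext N Y j))
    (hsucc : ∀ N : ModuleCat.{u} R, (∀ y : N, x • y = 0) →
      Subsingleton (Abelian.Ext N Y (j + 1)))
    (N : Type u) [AddCommGroup N] [Module R N] [hN : Module.Finite R N] :
    Subsingleton (Abelian.Ext (ModuleCat.of R N) Y j) := by
  refine IsNoetherianRing.induction_on_isQuotientEquivQuotientPrime R hN
    (motive := fun N _ _ _ => Subsingleton (Abelian.Ext (ModuleCat.of R N) Y j))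
    (fun N _ _ _ _ => h _ fun y => Subsingleton.elim (α := N) _ _) (fun N _ _ _ p e => ?_)
    (fun N₁ _ _ _ N₂ _ _ _ N₃ _ _ _ f g hf hg hfg h₁ h₃ => ?_)
  · by_cases hp : x ∈ p.asIdeal
    · refine h _ fun y => e.injective ?_
      obtain ⟨r, hr⟩ := Ideal.Quotient.mk_surjective (e y)
      rw [map_smul, map_zero, ← hr]
      exact Ideal.Quotient.eq_zero_iff_mem.mpr (Ideal.mul_mem_right r _ hp)
    · exact subsingleton_ext_of_isSMulRegular hxm
        ((e.isSMulRegular_congr x).mpr (isSMulRegular_quotient_of_isPrime hp))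
        (hsucc _ (smul_smulShortComplex_X₃_eq_zero _))
  · let S : ShortComplex (ModuleCat.{u} R) :=
      ModuleCat.shortComplexOfCompEqZero f g hfg.linearMap_comp_eq_zero
    have hS : S.ShortExact := ModuleCat.shortComplex_shortExact S hfg hf hg
    refine subsingleton_of_forall_eq 0 fun y => ?_
    obtain ⟨w, rfl⟩ := Abelian.Ext.contravariant_sequence_exact₂ hS Y y (h₁.elim _ _)
    rw [h₃.elim w 0, Abelian.Ext.comp_zero]

end Vanishing

section RegularElement

variable {R : Type u} [CommRing R] {x : R}

theorem subsingleton_ext_of_smul_eq_zero (hx : IsSMulRegular R x) {M : ModuleCat.{u} R}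
    (hM : IsSMulRegular M x) {n : ℕ}
    [HasInjectiveDimensionLE (ModuleCat.of (R ⧸ Ideal.span {x}) (QuotSMulTop x M)) n]
    (N : ModuleCat.{u} R) (hN : ∀ y : N, x • y = 0) {j : ℕ} (hj : n < j) :
    Subsingleton (Abelian.Ext N M (j + 1)) := by
  obtain ⟨N', ⟨e⟩⟩ := exists_iso_quotientRestrictScalars N hN
  rw [← Module.length_eq_zero_iff (R := R), ← length_ext_congr_left e,
    length_ext_quotientRestrictScalars hx hM, Module.length_eq_zero_iff]
  exact HasInjectiveDimensionLT.subsingleton _ (n + 1) _ hj _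

theorem hasInjectiveDimensionLE_succ_of_quotSMulTop [IsNoetherianRing R] [IsLocalRing R]
    (hx : IsSMulRegular R x) (hxm : x ∈ IsLocalRing.maximalIdeal R) {M : ModuleCat.{u} R}
    [Module.Finite R M] (hM : IsSMulRegular M x) {n : ℕ}
    [HasInjectiveDimensionLE (ModuleCat.of (R ⧸ Ideal.span {x}) (QuotSMulTop x M)) n] :
    HasInjectiveDimensionLE M (n + 1) :=
  hasInjectiveDimensionLT_of_subsingleton_ext (n + 1) M fun I =>
    subsingleton_ext_of_forall_smul_eq_zero hxm
      (fun N hN => subsingleton_ext_of_smul_eq_zero hx hM (n := n) N hN (Nat.lt_succ_self n))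
      (fun N hN => subsingleton_ext_of_smul_eq_zero hx hM (n := n) N hN (by omega)) (R ⧸ I)

open scoped Pointwise in
/-- The identification of `R ⧸ x R`, as formed for the module `R`, with the ring `R ⧸ (x)`. -/
noncomputable def quotSMulTopSelfEquiv (x : R) :
    QuotSMulTop x R ≃ₗ[R ⧸ Ideal.span {x}] R ⧸ Ideal.span {x} :=
  have h : x • (⊤ : Submodule R R) = Ideal.span {x} := by
    rw [← Submodule.ideal_span_singleton_smul, smul_eq_mul, Ideal.mul_top]
  (Submodule.quotEquivOfEq _ _ h).extendScalarsOfSurjective Ideal.Quotient.mk_surjective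

theorem hasInjectiveDimensionLE_succ_of_quotient [IsNoetherianRing R] [IsLocalRing R]
    (hx : IsSMulRegular R x) (hxm : x ∈ IsLocalRing.maximalIdeal R) {n : ℕ}
    (h : HasInjectiveDimensionLE (ModuleCat.of (R ⧸ Ideal.span {x}) (R ⧸ Ideal.span {x})) n) :
    HasInjectiveDimensionLE (ModuleCat.of R R) (n + 1) := by
  have := hasInjectiveDimensionLT_of_iso (quotSMulTopSelfEquiv x).toModuleIso.symm (n + 1)
  exact hasInjectiveDimensionLE_succ_of_quotSMulTop hx hxm (M := ModuleCat.of R R) hx (n := n)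

theorem isRegular_map_quotient {rs : List R} (h : RingTheory.Sequence.IsRegular R (x :: rs)) :
    RingTheory.Sequence.IsRegular (R ⧸ Ideal.span {x})
      (rs.map (Ideal.Quotient.mk (Ideal.span {x}))) :=
  ((quotSMulTopSelfEquiv x).isRegular_congr _).mp
    ((RingTheory.Sequence.isRegular_cons_iff' R x rs).mp h).2

variable [IsLocalRing R]

theorem nonempty_residueModule_iso [IsLocalRing (R ⧸ Ideal.span {x})] :
    Nonempty ((quotientRestrictScalars x).obj (residueModule (R ⧸ Ideal.span {x})) ≅
      residueModule R) := by
  have hlength : Module.length R (IsLocalRing.ResidueField (R ⧸ Ideal.span {x})) = 1 := by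
    rw [Module.length_eq_of_surjective (S := R) (R := R ⧸ Ideal.span {x})
      Ideal.Quotient.mk_surjective, Module.length_eq_one]
  have := Module.length_eq_one_iff.mp hlength
  obtain ⟨e⟩ := nonempty_residueField_equiv (R := R)
    (IsLocalRing.ResidueField (R ⧸ Ideal.span {x}))
  exact ⟨LinearEquiv.toModuleIso { e with map_smul' := e.map_smul' }⟩

theorem bassNumber_succ_of_isSMulRegular (hx : IsSMulRegular R x)
    [IsLocalRing (R ⧸ Ideal.span {x})] (n : ℕ) :
    bassNumber R (n + 1) = bassNumber (R ⧸ Ideal.span {x}) n := by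
  obtain ⟨e⟩ := nonempty_residueModule_iso (R := R) (x := x)
  rw [bassNumber_eq_toNat_length, bassNumber_eq_toNat_length, ← length_ext_congr_left e,
    length_ext_quotientRestrictScalars hx (M := ModuleCat.of R R) hx,
    length_ext_congr_right _ (quotSMulTopSelfEquiv x).toModuleIso]

theorem bassNumber_zero_of_isSMulRegular (hx : IsSMulRegular R x)
    (hxm : x ∈ IsLocalRing.maximalIdeal R) : bassNumber R 0 = 0 := by
  have : Subsingleton (IsLocalRing.ResidueField R →ₗ[R] R) :=
    IsSMulRegular.linearMap_subsingleton_of_mem_annihilator hx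
      (Module.mem_annihilator.mpr fun y => @isTorsionBySet_residueField R _ _ y ⟨x, hxm⟩)
  rw [bassNumber_eq_toNat_length, length_ext_zero, Module.length_eq_zero, ENat.toNat_zero]

end RegularElement

section CohenMacaulay

theorem mem_maximalIdeal_of_isRegular_cons {R : Type*} [CommRing R] [IsLocalRing R] {x : R}
    {rs : List R} (h : RingTheory.Sequence.IsRegular R (x :: rs)) :
    x ∈ IsLocalRing.maximalIdeal R := by
  simpa using fun hu => h.2 (by simp [Ideal.span_singleton_eq_top.mpr hu])

variable {R : Type u} [CommRing R] [IsNoetherianRing R] [IsLocalRing R]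

theorem exists_isRegular_of_isCohenMacaulay (h : IsCohenMacaulay R) :
    ∃ rs : List R, RingTheory.Sequence.IsRegular R rs ∧ ringKrullDim R = rs.length := by
  let P : List R → Prop := fun rs => (∀ r ∈ rs, r ∈ IsLocalRing.maximalIdeal R) ∧
    RingTheory.Sequence.IsRegular R rs
  have hdepth : depth R = ⨆ rs : {rs : List R // P rs}, (rs.1.length : ℕ∞) := iSup_subtype'
  have : Nonempty {rs : List R // P rs} :=
    ⟨⟨[], by simp, RingTheory.Sequence.IsRegular.nil R R⟩⟩
  have hlt : depth R < ⊤ := WithBot.coe_lt_coe.mp (h.trans_lt ringKrullDim_lt_top)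
  rw [hdepth] at hlt
  obtain ⟨⟨rs, hP⟩, hrs⟩ := ENat.exists_eq_iSup_of_lt_top hlt
  refine ⟨rs, hP.2, ?_⟩
  rw [← h, hdepth, ← hrs]
  rfl

theorem ringKrullDim_quotient_span_singleton_eq {x : R} (hx : IsSMulRegular R x)
    (hxm : x ∈ IsLocalRing.maximalIdeal R) {d : ℕ} (hd : ringKrullDim R = (d + 1 : ℕ)) :
    ringKrullDim (R ⧸ Ideal.span {x}) = d := by
  have h := ringKrullDim_quotient_span_singleton_succ_eq_ringKrullDim hx hxm
  rw [hd, Nat.cast_add, Nat.cast_one] at h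
  exact le_antisymm ((ENat.WithBot.add_le_add_natCast_right_iff (c := 1)).mp (by simpa using h.le))
    ((ENat.WithBot.add_le_add_natCast_right_iff (c := 1)).mp (by simpa using h.ge))

theorem eq_zero_and_injective_of_bassNumber_eq_one (hdim : ringKrullDim R = 0) {n : ℕ}
    (hn : bassNumber R n = 1) : n = 0 ∧ Injective (ModuleCat.of R R) := by
  have : Ring.KrullDimLE 0 R := Ring.krullDimLE_iff.mpr hdim.le
  have : IsArtinianRing R :=
    isArtinianRing_iff_isNoetherianRing_krullDimLE_zero.mpr ⟨inferInstance, this⟩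
  have := injective_self_of_bassNumber_eq_one hn
  refine ⟨?_, Module.injective_object_of_injective_module R R⟩
  cases n with
  | zero => rfl
  | succ n => exact absurd ((bassNumber_succ_of_injective n).symm.trans hn) zero_ne_one

theorem eq_length_and_hasInjectiveDimensionLE_of_bassNumber_eq_one {rs : List R}
    (hrs : RingTheory.Sequence.IsRegular R rs) (hdim : ringKrullDim R = rs.length) {n : ℕ}
    (hn : bassNumber R n = 1) :
    n = rs.length ∧ HasInjectiveDimensionLE (ModuleCat.of R R) rs.length := by
  induction hd : rs.length generalizing R n with
  | zero =>
    obtain ⟨hn₀, _⟩ := eq_zero_and_injective_of_bassNumber_eq_one (by simpa [hd] using hdim) hn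
    exact ⟨hn₀, inferInstanceAs (HasInjectiveDimensionLT (ModuleCat.of R R) 1)⟩
  | succ d ih =>
    obtain ⟨x, rs, rfl⟩ := List.exists_cons_of_length_eq_add_one hd
    have hx : IsSMulRegular R x := ((RingTheory.Sequence.isRegular_cons_iff R x rs).mp hrs).1
    have hxm := mem_maximalIdeal_of_isRegular_cons hrs
    have : Nontrivial (R ⧸ Ideal.span {x}) := Ideal.Quotient.nontrivial_iff.mpr
      (by rwa [Ne, Ideal.span_singleton_eq_top])
    have : IsLocalRing (R ⧸ Ideal.span {x}) :=
      IsLocalRing.of_surjective' (Ideal.Quotient.mk (Ideal.span {x})) Ideal.Quotient.mk_surjective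
    cases n with
    | zero => exact absurd ((bassNumber_zero_of_isSMulRegular hx hxm).symm.trans hn) zero_ne_one
    | succ n =>
      have hlength : (rs.map (Ideal.Quotient.mk (Ideal.span {x}))).length = d := by simpa using hd
      obtain ⟨rfl, hinj⟩ := ih (isRegular_map_quotient hrs)
        (hlength ▸ ringKrullDim_quotient_span_singleton_eq hx hxm (hd ▸ hdim))
        ((bassNumber_succ_of_isSMulRegular hx n).symm.trans hn) hlength
      exact ⟨rfl, hasInjectiveDimensionLE_succ_of_quotient hx hxm hinj⟩

end CohenMacaulay

end LocalAlgebra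

theorem mainTheorem4 :
    (∀ (R : Type u) [CommRing R] [IsNoetherianRing R] [IsLocalRing R] (n : ℕ),
      LocalAlgebra.IsCohenMacaulay R → LocalAlgebra.bassNumber R n = 1 →
        LocalAlgebra.IsGorenstein R ∧ ringKrullDim R = n) ∧
    (∀ (R : Type u) [CommRing R] [IsArtinianRing R] [IsLocalRing R]
      (M : Type u) [AddCommGroup M] [Module R M] [Module.Finite R M],
      ¬ Module.Free R M → Module.length R R ∣ Module.length R M →
        (∀ i : ℕ, 2 ≤ LocalAlgebra.bettiNumber R M i) ∧
        (Module.length R M = Module.length R R →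
          LocalAlgebra.bettiNumber R M 0 ≤ LocalAlgebra.bettiNumber R M 1)) := by
  refine ⟨fun R _ _ _ n hR hn => ?_, fun R _ _ _ M _ _ _ hM hd =>
    ⟨LocalAlgebra.two_le_bettiNumber hM hd, LocalAlgebra.bettiNumber_zero_le_bettiNumber_one hM⟩⟩
  obtain ⟨rs, hrs, hdim⟩ := LocalAlgebra.exists_isRegular_of_isCohenMacaulay hR
  obtain ⟨rfl, hinj⟩ :=
    LocalAlgebra.eq_length_and_hasInjectiveDimensionLE_of_bassNumber_eq_one hrs hdim hn
  exact ⟨⟨_, hinj⟩, hdim⟩
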